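/- Let $d\in\mathbb N$, $n\ge 3$, $0=t_1<t_2<\dots<t_n=1$, and let $\rho_1,\dots,\rho_n$ be compactly supported Borel probability measures on $\mathbb R^d$, with $\rho_1$ atomless. Let $\mathcal H=H^2([0,1],\mathbb R^d)$ be the Sobolev space of paths with square-integrable weak first and second derivatives (each path identified with its continuous representative), equipped with its Borel $\sigma$-algebra, and let $e_t(x)=x(t)$. **Kantorovich problem.** Let $$K=\inf_{\mu}\int_{\mathcal H}\int_0^1|\ddot x(t)|^2\,dt\,d\mu(x),$$ where $\mu$ runs over the Borel probability measures on $\mathcal H$ with $(e_{t_i})_*\mu=\rho_i$ for $i=1,\dots,n$. **Monge spline problem.** For a reference probability measure $\mu_0$ on $\mathbb R^d$, let $$MS(\mu_0)=\inf_{\varphi}\int_{\mathbb R^d}\int_0^1|\ddot\varphi(t,x)|^2\,dt\,d\mu_0(x),$$ where $\varphi$ runs over the time-dependent maps $\varphi:[0,1]\times\mathbb R^d\to\mathbb R^d$ such that $\varphi(t,\cdot)$ is Borel for every $t$, $\varphi(\cdot,x)\in\mathcal H$ for every $x$, and $\varphi(t_i,\cdot)_*\mu_0=\rho_i$ for $i=1,\dots,n$.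 Let $MS_{\mathrm{id}}$ be the infimum of the same functional for $\mu_0=\rho_1$ over those admissible $\varphi$ that moreover satisfy $\varphi(0,x)=x$ for all $x$. Then: 1. $MS(\mu_0)=K$ for every atomless Borel probability measure $\mu_0$ on $\mathbb R^d$ (in particular for $\mu_0=\rho_1$); 2. $MS_{\mathrm{id}}=K$; 3. $K<\infty$, and $K$ is attained: there is an admissible $\mu$ whose cost is $K$. -/

import Mathlib

open MeasureTheory Set
open scoped ENNReal ContDiff unitInterval

noncomputable section

namespace WassersteinSpline

/-- The Euclidean space `ℝ^d`. -/
abbrev Rd (d : ℕ) : Type := EuclideanSpace ℝ (Fin d)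

/-- The space `L²([0,1], ℝ^d)` (Lebesgue measure on `[0,1]`). -/
abbrev L2Path (d : ℕ) : Type := Lp (Rd d) 2 (volume : Measure I)

/-- `g` is the weak (distributional) derivative of `f` on `(0,1)`:
`∫ ψ' f = - ∫ ψ g` for every smooth `ψ` compactly supported in `(0,1)`. -/
def IsWeakDeriv {d : ℕ} (f g : I → Rd d) : Prop :=
  ∀ ψ : ℝ → ℝ, ContDiff ℝ ∞ ψ → HasCompactSupport ψ → tsupport ψ ⊆ Ioo (0 : ℝ) 1 →
    ∫ s : I, deriv ψ (s : ℝ) • f s = - ∫ s : I, ψ (s : ℝ) • g s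

/-- The Sobolev path space `H²([0,1], ℝ^d)`: a path (given by its continuous representative)
together with its weak first and second derivatives, both in `L²`. The derivatives are determined
by the path. The topology is the one inherited from `C⁰ × L² × L²`, i.e. that of the norm
`max (‖x‖_∞, ‖x'‖_{L²}, ‖x''‖_{L²})`, which is equivalent to the usual Hilbert norm of `H²`
because `H²([0,1])` embeds continuously in `C⁰([0,1])`. -/
def H2Path (d : ℕ) : Type :=
  {p : C(I, Rd d) × L2Path d × L2Path d //
    IsWeakDeriv (fun s => p.1 s) (fun s => p.2.1 s) ∧
    IsWeakDeriv (fun s => p.2.1 s) (fun s => p.2.2 s)}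

instance (d : ℕ) : TopologicalSpace (H2Path d) :=
  inferInstanceAs (TopologicalSpace (Subtype _))

/-- The path space carries its Borel σ-algebra. -/
instance (d : ℕ) : MeasurableSpace (H2Path d) := borel (H2Path d)

instance (d : ℕ) : BorelSpace (H2Path d) := ⟨rfl⟩

/-- The evaluation map `e_s : H²([0,1], ℝ^d) → ℝ^d`, `x ↦ x(s)`. -/
def eval {d : ℕ} (s : I) (x : H2Path d) : Rd d := x.1.1 s

/-- The acceleration `ẍ ∈ L²([0,1], ℝ^d)` of a path `x ∈ H²([0,1], ℝ^d)`. -/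
def acc {d : ℕ} (x : H2Path d) : L2Path d := x.1.2.2

/-- `|ẍ|² = ∫₀¹ |ẍ(s)|² ds`. -/
def energy {d : ℕ} (x : H2Path d) : ℝ≥0∞ := ∫⁻ s : I, ‖acc x s‖ₑ ^ 2

/-- Evaluation is continuous, hence Borel, so that the image measures `[e_s]_* μ` make sense. -/
theorem continuous_eval {d : ℕ} (s : I) : Continuous (eval s : H2Path d → Rd d) :=
  (ContinuousEvalConst.continuous_eval_const (F := C(I, Rd d)) s).comp
    (continuous_fst.comp continuous_subtype_val)

/-- Admissible measures of the Kantorovich problem: probability measures `μ` on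
`H²([0,1], ℝ^d)` with `[e_{t_i}]_* μ = ρ_i` for all `i`. -/
structure KantorovichAdmissible {d n : ℕ} (t : Fin n → I) (ρ : Fin n → Measure (Rd d))
    (μ : Measure (H2Path d)) : Prop where
  isProbabilityMeasure : IsProbabilityMeasure μ
  marginal : ∀ i, μ.map (eval (t i)) = ρ i

/-- The Kantorovich cost `∫_{H²} |ẍ|² dμ(x)`. -/
def kantorovichCost {d : ℕ} (μ : Measure (H2Path d)) : ℝ≥0∞ := ∫⁻ x, energy x ∂μ

/-- The infimum of the Kantorovich problem. -/
def kantorovichInf {d n : ℕ} (t : Fin n → I) (ρ : Fin n → Measure (Rd d)) : ℝ≥0∞ :=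
  ⨅ (μ : Measure (H2Path d)) (_ : KantorovichAdmissible t ρ μ), kantorovichCost μ

/-- Admissible time-dependent maps `φ(s) : ℝ^d → ℝ^d`, `φ(s)(x) = eval s (φ x)`, of the Monge
problem with reference measure `μ₀`: every trajectory `s ↦ φ(s)(x)` is in `H²`, every `φ(s)` is a
Borel map, and `φ(t_i)_* μ₀ = ρ_i` for all `i`. -/
structure MongeAdmissible {d n : ℕ} (μ₀ : Measure (Rd d)) (t : Fin n → I)
    (ρ : Fin n → Measure (Rd d)) (φ : Rd d → H2Path d) : Prop where
  measurable : ∀ s, Measurable fun x => eval s (φ x)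
  marginal : ∀ i, μ₀.map (fun x => eval (t i) (φ x)) = ρ i

/-- The Monge cost `∫_{ℝ^d} ∫₀¹ |φ̈(s)(x)|² ds dμ₀(x)`. -/
def mongeCost {d : ℕ} (μ₀ : Measure (Rd d)) (φ : Rd d → H2Path d) : ℝ≥0∞ :=
  ∫⁻ x, energy (φ x) ∂μ₀

/-- The infimum of the Monge spline problem (MS) with reference measure `μ₀`. -/
def mongeInf {d n : ℕ} (μ₀ : Measure (Rd d)) (t : Fin n → I) (ρ : Fin n → Measure (Rd d)) :
    ℝ≥0∞ :=
  ⨅ (φ : Rd d → H2Path d) (_ : MongeAdmissible μ₀ t ρ φ), mongeCost μ₀ φ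

/-- The infimum of the Monge spline problem (MS) with reference measure `μ₀`, restricted to the
time-dependent maps that start at the identity, `φ(0) = id`. -/
def mongeInfId {d n : ℕ} (μ₀ : Measure (Rd d)) (t : Fin n → I) (ρ : Fin n → Measure (Rd d)) :
    ℝ≥0∞ :=
  ⨅ (φ : Rd d → H2Path d) (_ : MongeAdmissible μ₀ t ρ φ) (_ : ∀ x, eval 0 (φ x) = x),
    mongeCost μ₀ φ

end WassersteinSpline

end

/-!
Among the paths through prescribed points at the times `t i`, a path of least energy can be chosen
linearly and continuously in these points: a spline. Pushing a measure on paths to its values at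
the times `t i`, and back along the spline, turns the Kantorovich problem into a multi-marginal
transport problem with a continuous cost over the compact set of couplings, whence its minimizer.

An atomless measure can be transported onto any probability measure on a Polish space, here the
space of paths, so every Kantorovich competitor is the law of a Monge competitor. To start at the
identity, transport the first marginal to the law of paths separately over small cells of the space
of initial points: the resulting path starts close to `x`, and adding a spline which corrects its
initial point turns the energy `E` into at most `(1 + η) E + η² + η`, where `η → 0` with the size of
the cells.
-/

noncomputable section

namespace WassersteinSpline

open ProbabilityTheory Filter Topology
open scoped Distributions

/-! ### Transport of atomless measures -/

section Transport

theorem continuous_cdf (ν : Measure ℝ) [IsProbabilityMeasure ν] [NullSingletonClass ν] :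
    Continuous (cdf ν) := by
  refine continuous_iff_continuousAt.2 fun x => ?_
  have hjump : ENNReal.ofReal (cdf ν x - Function.leftLim (cdf ν) x) = 0 := by
    rw [← (cdf ν).measure_singleton x, measure_cdf, measure_singleton]
  rw [(monotone_cdf ν).continuousAt_iff_leftLim_eq_rightLim, (cdf ν).rightLim_eq x]
  exact le_antisymm ((monotone_cdf ν).leftLim_le le_rfl)
    (sub_nonpos.1 (ENNReal.ofReal_eq_zero.1 hjump))

theorem measure_setOf_cdf_le (ν : Measure ℝ) [IsProbabilityMeasure ν] [NullSingletonClass ν]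
    {a : ℝ} (ha₀ : 0 ≤ a) (ha₁ : a ≤ 1) : ν {x | cdf ν x ≤ a} = ENNReal.ofReal a := by
  set S : Set ℝ := {x | cdf ν x ≤ a}
  rcases ha₁.eq_or_lt with rfl | ha
  · simp [S, cdf_le_one]
  rcases S.eq_empty_or_nonempty with hempty | hne
  · have ha_le : ∀ x, a ≤ cdf ν x := fun x => (not_le.1 (eq_empty_iff_forall_notMem.1 hempty x)).le
    have : a = 0 := (ge_of_tendsto' (tendsto_cdf_atBot ν) ha_le).antisymm ha₀
    rw [hempty, this, measure_empty, ENNReal.ofReal_zero]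
  have hbdd : BddAbove S := by
    obtain ⟨b, hb⟩ := ((tendsto_cdf_atTop ν).eventually (eventually_gt_nhds ha)).exists
    exact ⟨b, fun x hx => not_lt.1 fun h => (hb.trans_le (monotone_cdf ν h.le)).not_ge hx⟩
  have hmem : cdf ν (sSup S) ≤ a :=
    (isClosed_le (continuous_cdf ν) continuous_const).csSup_mem hne hbdd
  have hge : a ≤ cdf ν (sSup S) :=
    ge_of_tendsto ((continuous_cdf ν).continuousWithinAt (s := Ioi (sSup S)))
      (eventually_nhdsWithin_of_forall fun y hy =>
        (not_le.1 (notMem_of_csSup_lt (s := S) hy hbdd)).le)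
  have hS : S = Iic (sSup S) :=
    Subset.antisymm (fun x hx => le_csSup hbdd hx) fun x hx => (monotone_cdf ν hx).trans hmem
  rw [hS, ← ofReal_cdf, hmem.antisymm hge]

theorem exists_measurable_map_eq_volume (ν : Measure ℝ) [IsProbabilityMeasure ν]
    [NullSingletonClass ν] : ∃ F : ℝ → I, Measurable F ∧ ν.map F = volume := by
  let F : ℝ → I := fun x => ⟨cdf ν x, cdf_nonneg ν x, cdf_le_one ν x⟩
  have hF : Measurable F := ((continuous_cdf ν).subtype_mk _).measurable
  have := Measure.isProbabilityMeasure_map (μ := ν) hF.aemeasurable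
  refine ⟨F, hF, Measure.ext_of_Iic _ _ fun a => ?_⟩
  rw [Measure.map_apply hF measurableSet_Iic, unitInterval.volume_Iic]
  exact measure_setOf_cdf_le ν a.2.1 a.2.2

variable {X Y : Type*} [MeasurableSpace X] [StandardBorelSpace X] [MeasurableSpace Y]
  [StandardBorelSpace Y] [Nonempty Y]

theorem exists_measurable_map_eq_of_isProbabilityMeasure (μ : Measure X) [IsProbabilityMeasure μ]
    [NullSingletonClass μ] (ν : Measure Y) [IsProbabilityMeasure ν] :
    ∃ T : X → Y, Measurable T ∧ μ.map T = ν := by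
  have he := measurableEmbedding_embeddingReal X
  have := Measure.isProbabilityMeasure_map (μ := μ) he.measurable.aemeasurable
  have : NullSingletonClass (μ.map (embeddingReal X)) := ⟨fun x => by
    rw [he.map_apply]
    exact (subsingleton_singleton.preimage he.injective).measure_zero μ⟩
  obtain ⟨F, hF, hmapF⟩ := exists_measurable_map_eq_volume (μ.map (embeddingReal X))
  obtain ⟨f, hf, hmapf⟩ := ν.exists_measurable_map_eq
  refine ⟨f ∘ F ∘ embeddingReal X, hf.comp (hF.comp he.measurable), ?_⟩
  rw [← Measure.map_map hf (hF.comp he.measurable), ← Measure.map_map hF he.measurable,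
    hmapF, hmapf]

theorem exists_measurable_map_eq (μ : Measure X) [IsFiniteMeasure μ] [NullSingletonClass μ]
    (ν : Measure Y) (hmass : μ univ = ν univ) : ∃ T : X → Y, Measurable T ∧ μ.map T = ν := by
  rcases eq_zero_or_neZero μ with rfl | hμ
  · refine ⟨fun _ => Classical.arbitrary Y, measurable_const, ?_⟩
    rw [Measure.map_zero, eq_comm, ← Measure.measure_univ_eq_zero, ← hmass, Measure.coe_zero,
      Pi.zero_apply]
  have : IsFiniteMeasure ν := ⟨hmass ▸ measure_lt_top μ univ⟩
  have : NeZero ν := ⟨by rw [← Measure.measure_univ_ne_zero, ← hmass]; exact NeZero.ne _⟩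
  have : NullSingletonClass ((μ univ)⁻¹ • μ) := ⟨fun x => by simp⟩
  obtain ⟨T, hT, hmap⟩ :=
    exists_measurable_map_eq_of_isProbabilityMeasure ((μ univ)⁻¹ • μ) ((ν univ)⁻¹ • ν)
  refine ⟨T, hT, ?_⟩
  have hrescale := congrArg (μ univ • ·) hmap
  simpa only [Measure.map_smul, ← hmass, smul_smul, one_smul,
    ENNReal.mul_inv_cancel (NeZero.ne (μ univ)) (measure_ne_top μ univ)] using hrescale

theorem sum_restrict_preimage_singleton {X κ : Type*} [MeasurableSpace X] [MeasurableSpace κ]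
    [MeasurableSingletonClass κ] [Countable κ] (μ : Measure X) {p : X → κ} (hp : Measurable p) :
    Measure.sum (fun j => μ.restrict (p ⁻¹' {j})) = μ := by
  rw [← Measure.restrict_iUnion (fun i j hij => Disjoint.preimage p (by simpa using hij))
    fun j => hp (measurableSet_singleton j), ← preimage_iUnion, iUnion_of_singleton, preimage_univ,
    Measure.restrict_univ]

theorem exists_measurable_map_eq_of_map_eq {κ : Type*} [MeasurableSpace κ]
    [MeasurableSingletonClass κ] [Countable κ] (μ : Measure X) [IsFiniteMeasure μ]
    [NullSingletonClass μ] (ν : Measure Y) {p : X → κ} {q : Y → κ} (hp : Measurable p)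
    (hq : Measurable q) (hpq : μ.map p = ν.map q) :
    ∃ T : X → Y, Measurable T ∧ μ.map T = ν ∧ ∀ᵐ x ∂μ, q (T x) = p x := by
  have hp_fiber : ∀ j, MeasurableSet (p ⁻¹' {j}) := fun j => hp (measurableSet_singleton j)
  have hq_fiber : ∀ j, MeasurableSet (q ⁻¹' {j}) := fun j => hq (measurableSet_singleton j)
  have htransport : ∀ j, ∃ T : X → Y, Measurable T ∧
      (μ.restrict (p ⁻¹' {j})).map T = ν.restrict (q ⁻¹' {j}) := fun j => by
    refine exists_measurable_map_eq _ _ ?_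
    rw [Measure.restrict_apply_univ, Measure.restrict_apply_univ,
      ← Measure.map_apply hp (measurableSet_singleton j),
      ← Measure.map_apply hq (measurableSet_singleton j), hpq]
  choose T hT hmap using htransport
  let S : X → Y := fun x => T (p x) x
  have hS : Measurable S :=
    (measurable_from_prod_countable_right (f := fun z : κ × X => T z.1 z.2) hT).comp
      (hp.prodMk measurable_id)
  have hS_fiber : ∀ j, (μ.restrict (p ⁻¹' {j})).map S = ν.restrict (q ⁻¹' {j}) := fun j => by
    rw [← hmap j]
    refine Measure.map_congr ?_
    filter_upwards [ae_restrict_mem (hp_fiber j)] with x (hx : p x = j)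
    simp only [S, hx]
  refine ⟨S, hS, ?_, ?_⟩
  · rw [← sum_restrict_preimage_singleton μ hp, Measure.map_sum hS.aemeasurable, funext hS_fiber,
      sum_restrict_preimage_singleton ν hq]
  · rw [← sum_restrict_preimage_singleton μ hp, Measure.ae_sum_iff]
    intro j
    have hq_map : ∀ᵐ y ∂((μ.restrict (p ⁻¹' {j})).map S), q y = j := by
      rw [hS_fiber]; exact ae_restrict_mem (hq_fiber j)
    filter_upwards [ae_of_ae_map hS.aemeasurable hq_map, ae_restrict_mem (hp_fiber j)]
      with x hqx (hpx : p x = j)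
    rw [hqx, hpx]

theorem exists_measurable_dist_le_of_eq {X : Type*} [PseudoMetricSpace X]
    [TopologicalSpace.SeparableSpace X] [Nonempty X] [MeasurableSpace X] [OpensMeasurableSpace X]
    {δ : ℝ} (hδ : 0 < δ) : ∃ q : X → ℕ, Measurable q ∧ ∀ x y, q x = q y → dist x y ≤ δ := by
  classical
  have hnear : ∀ x : X, ∃ k, dist x (TopologicalSpace.denseSeq X k) < δ / 2 := fun x =>
    (TopologicalSpace.denseRange_denseSeq X).exists_dist_lt x (half_pos hδ)
  refine ⟨fun x => Nat.find (hnear x), measurable_find hnear fun k => measurableSet_ball,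
    fun x y hxy => ?_⟩
  have hx := Nat.find_spec (hnear x)
  have hy := Nat.find_spec (hnear y)
  rw [← show Nat.find (hnear x) = Nat.find (hnear y) from hxy] at hy
  linarith [dist_triangle_right x y (TopologicalSpace.denseSeq X (Nat.find (hnear x)))]

theorem exists_measurable_map_eq_dist_le {X : Type*} [PseudoMetricSpace X]
    [TopologicalSpace.SeparableSpace X] [MeasurableSpace X] [OpensMeasurableSpace X]
    [StandardBorelSpace X] (μ : Measure X) [IsFiniteMeasure μ] [NullSingletonClass μ]
    (ν : Measure Y) {e : Y → X} (he : Measurable e) (hmap : ν.map e = μ) {δ : ℝ} (hδ : 0 < δ) :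
    ∃ T : X → Y, Measurable T ∧ μ.map T = ν ∧ ∀ᵐ x ∂μ, dist x (e (T x)) ≤ δ := by
  have : Nonempty X := ‹Nonempty Y›.map e
  obtain ⟨q, hq, hdist⟩ := exists_measurable_dist_le_of_eq (X := X) hδ
  obtain ⟨T, hT, hmapT, hqT⟩ := exists_measurable_map_eq_of_map_eq μ ν hq (hq.comp he)
    (by rw [← hmap, Measure.map_map hq he])
  exact ⟨T, hT, hmapT, hqT.mono fun x hx => hdist _ _ hx.symm⟩

end Transport

/-! ### Weak derivatives -/

section Primitive

variable {α E : Type*} [TopologicalSpace α] [LinearOrder α] [OrderClosedTopology α]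
  [MeasurableSpace α] [OpensMeasurableSpace α] {μ : Measure α} [NormedAddCommGroup E]
  [NormedSpace ℝ E]

theorem continuous_setIntegral_Iic [FirstCountableTopology α] [NullSingletonClass μ] {g : α → E}
    (hg : Integrable g μ) : Continuous fun r => ∫ s in Iic r, g s ∂μ := by
  simp only [← integral_indicator measurableSet_Iic]
  refine continuous_iff_continuousAt.2 fun r₀ => continuousAt_of_dominated
    (Eventually.of_forall fun r => (hg.indicator measurableSet_Iic).aestronglyMeasurable)
    (Eventually.of_forall fun r => ae_of_all _ fun s => norm_indicator_le_norm_self _ _)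
    hg.norm ?_
  filter_upwards [Measure.ae_ne μ r₀] with s hs
  rcases lt_or_gt_of_ne hs with hlt | hgt
  · refine (continuousAt_const (y := g s)).congr ?_
    filter_upwards [eventually_gt_nhds hlt] with r hr
    rw [indicator_of_mem (mem_Iic.2 hr.le)]
  · refine (continuousAt_const (y := (0 : E))).congr ?_
    filter_upwards [eventually_lt_nhds hgt] with r hr
    rw [indicator_of_notMem (notMem_Iic.2 hr)]

theorem integral_smul_setIntegral_Iic [SecondCountableTopology α] [SFinite μ] [CompleteSpace E]
    {k : α → ℝ} {g : α → E} (hk : Integrable k μ) (hg : Integrable g μ) :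
    ∫ r, k r • ∫ s in Iic r, g s ∂μ ∂μ = ∫ s, (∫ r in Ici s, k r ∂μ) • g s ∂μ := by
  have hind : ∀ r s, k r • (Iic r).indicator g s = (Ici s).indicator k r • g s := fun r s => by
    by_cases h : s ≤ r <;> simp [indicator, h]
  have hint : Integrable (Function.uncurry fun r s => (Ici s).indicator k r • g s) (μ.prod μ) := by
    refine ((hk.smul_prod hg).indicator (measurableSet_le measurable_snd measurable_fst)).congr
      (ae_of_all _ fun z => ?_)
    by_cases h : z.2 ≤ z.1 <;> simp [indicator, h, Function.uncurry]
  simp_rw [← integral_indicator measurableSet_Iic, ← integral_smul, hind]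
  rw [integral_integral_swap hint]
  simp_rw [integral_smul_const, integral_indicator measurableSet_Ici]

end Primitive

section WeakDerivative

theorem integral_unitInterval {E : Type*} [NormedAddCommGroup E] [NormedSpace ℝ E] (F : ℝ → E) :
    ∫ s : I, F s = ∫ x in (0 : ℝ)..1, F x := by
  rw [unitInterval.measurePreserving_coe.integral_comp unitInterval.measurableEmbedding_coe F,
    intervalIntegral.integral_of_le zero_le_one, ← integral_Icc_eq_integral_Ioc]

/-- The open unit interval, on which the test functions of `IsWeakDeriv` live. -/
def openUnitInterval : TopologicalSpace.Opens ℝ := ⟨Ioo 0 1, isOpen_Ioo⟩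

/-- A test function on the open unit interval, as a continuous function on `[0,1]`. -/
def testValue (ψ : 𝓓(openUnitInterval, ℝ)) : C(I, ℝ) :=
  ⟨fun s => ψ s, ψ.continuous.comp continuous_subtype_val⟩

/-- The derivative of a test function on the open unit interval, as a continuous function on
`[0,1]`. -/
def testDeriv (ψ : 𝓓(openUnitInterval, ℝ)) : C(I, ℝ) :=
  ⟨fun s => deriv ψ s, (ψ.contDiff.continuous_deriv (by simp)).comp continuous_subtype_val⟩

theorem hasDerivAt_test (ψ : 𝓓(openUnitInterval, ℝ)) (x : ℝ) : HasDerivAt ψ (deriv ψ x) x :=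
  (ψ.contDiff.differentiable (by simp) x).hasDerivAt

theorem intervalIntegrable_deriv_test (ψ : 𝓓(openUnitInterval, ℝ)) (a b : ℝ) :
    IntervalIntegrable (deriv ψ) volume a b :=
  (ψ.contDiff.continuous_deriv (by simp)).intervalIntegrable a b

theorem test_eq_zero_of_notMem (ψ : 𝓓(openUnitInterval, ℝ)) {x : ℝ} (hx : x ∉ Ioo (0 : ℝ) 1) :
    ψ x = 0 :=
  image_eq_zero_of_notMem_tsupport fun h => hx (ψ.tsupport_subset h)

theorem integral_Ici_testDeriv (ψ : 𝓓(openUnitInterval, ℝ)) (s : I) :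
    ∫ r in Ici s, testDeriv ψ r = -testValue ψ s := by
  have hIcc : Icc (0 : ℝ) 1 ∩ Ici (s : ℝ) = Icc (s : ℝ) 1 := by
    rw [← Ici_inter_Iic, inter_right_comm, Ici_inter_Ici, sup_eq_right.2 s.2.1, Ici_inter_Iic]
  calc ∫ r in Ici s, testDeriv ψ r
      = ∫ r : I, (Ici (s : ℝ)).indicator (deriv ψ) r := by
        rw [← integral_indicator measurableSet_Ici]; rfl
    _ = ∫ x in (s : ℝ)..1, deriv ψ x := by
        rw [integral_unitInterval, intervalIntegral.integral_of_le zero_le_one,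
          ← integral_Icc_eq_integral_Ioc, setIntegral_indicator measurableSet_Ici, hIcc,
          integral_Icc_eq_integral_Ioc, intervalIntegral.integral_of_le s.2.2]
    _ = ψ 1 - ψ s := intervalIntegral.integral_eq_sub_of_hasDerivAt
        (fun x _ => hasDerivAt_test ψ x) (intervalIntegrable_deriv_test ψ _ _)
    _ = -testValue ψ s := by rw [test_eq_zero_of_notMem ψ (by simp), zero_sub]; rfl

variable {d : ℕ} {f f' g g' : I → Rd d}

theorem isWeakDeriv_iff : IsWeakDeriv f g ↔ ∀ ψ : 𝓓(openUnitInterval, ℝ),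
    ∫ s, testDeriv ψ s • f s = -∫ s, testValue ψ s • g s :=
  ⟨fun h ψ => h ψ ψ.contDiff ψ.hasCompactSupport ψ.tsupport_subset,
    fun h ψ hψ hcompact hsupp => h ⟨ψ, hψ, hcompact, hsupp⟩⟩

theorem IsWeakDeriv.congr_ae (h : IsWeakDeriv f g) (hf : f =ᵐ[volume] f') (hg : g =ᵐ[volume] g') :
    IsWeakDeriv f' g' := by
  refine isWeakDeriv_iff.2 fun ψ => ?_
  calc ∫ s, testDeriv ψ s • f' s = ∫ s, testDeriv ψ s • f s :=
        integral_congr_ae ((ae_eq_refl (testDeriv ψ)).smul hf.symm)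
    _ = -∫ s, testValue ψ s • g s := isWeakDeriv_iff.1 h ψ
    _ = -∫ s, testValue ψ s • g' s :=
        congrArg Neg.neg (integral_congr_ae ((ae_eq_refl (testValue ψ)).smul hg))

theorem isWeakDeriv_of_hasDerivAt {f f' : ℝ → Rd d} (hf : ∀ x, HasDerivAt f (f' x) x)
    (hf' : Continuous f') : IsWeakDeriv (fun s : I => f s) (fun s : I => f' s) := by
  refine isWeakDeriv_iff.2 fun ψ => ?_
  change ∫ s : I, deriv ψ s • f s = -∫ s : I, ψ s • f' s
  rw [integral_unitInterval fun x => deriv ψ x • f x, integral_unitInterval fun x => ψ x • f' x,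
    intervalIntegral.integral_smul_deriv_eq_deriv_smul (fun x _ => hasDerivAt_test ψ x)
      (fun x _ => hf x) (intervalIntegrable_deriv_test ψ _ _) (hf'.intervalIntegrable _ _),
    test_eq_zero_of_notMem ψ (by simp), test_eq_zero_of_notMem ψ (by simp)]
  simp only [zero_smul, sub_zero, zero_sub, neg_neg]

theorem isWeakDeriv_setIntegral_Iic (hg : Integrable g) :
    IsWeakDeriv (fun r => ∫ s in Iic r, g s) g := by
  refine isWeakDeriv_iff.2 fun ψ => ?_
  have hψ : Integrable (testDeriv ψ) volume :=
    (testDeriv ψ).continuous.integrable_of_hasCompactSupport (HasCompactSupport.of_compactSpace _)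
  rw [integral_smul_setIntegral_Iic hψ hg]
  simp_rw [integral_Ici_testDeriv, neg_smul]
  exact integral_neg _

theorem ae_eq_zero_of_integral_testValue_smul_eq_zero {E : Type*} [NormedAddCommGroup E]
    [NormedSpace ℝ E] [CompleteSpace E] {w : I → E} (hw : Integrable w)
    (h : ∀ ψ : 𝓓(openUnitInterval, ℝ), ∫ s, testValue ψ s • w s = 0) : w =ᵐ[volume] 0 := by
  have hcoe := unitInterval.measurableEmbedding_coe
  let W : ℝ → E := fun x => w (projIcc 0 1 zero_le_one x)
  have hWw : ∀ s : I, W s = w s := fun s => congrArg w (projIcc_val _ s)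
  have hW : Integrable W (volume.map ((↑) : I → ℝ)) :=
    hcoe.integrable_map_iff.2 (hw.congr (ae_of_all _ fun s => (hWw s).symm))
  have hW0 : ∀ᵐ x ∂(volume.map ((↑) : I → ℝ)), x ∈ Ioo (0 : ℝ) 1 → W x = 0 := by
    refine isOpen_Ioo.ae_eq_zero_of_integral_contDiff_smul_eq_zero
      (hW.locallyIntegrable.locallyIntegrableOn _) fun ψ hψ hcompact hsupp => ?_
    rw [hcoe.integral_map]
    simp_rw [hWw]
    exact h ⟨ψ, hψ, hcompact, hsupp⟩
  filter_upwards [hcoe.ae_map_iff.1 hW0, Measure.ae_ne volume 0, Measure.ae_ne volume 1]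
    with s hs hs0 hs1
  rw [← hWw, Pi.zero_apply]
  exact hs ⟨unitInterval.pos_iff_ne_zero.2 hs0, unitInterval.lt_one_iff_ne_one.2 hs1⟩

theorem IsWeakDeriv.unique (hg : IsWeakDeriv f g) (hg' : IsWeakDeriv f g') (hint : Integrable g)
    (hint' : Integrable g') : g =ᵐ[volume] g' := by
  have hψ : ∀ (ψ : 𝓓(openUnitInterval, ℝ)) {z : I → Rd d}, Integrable z →
      Integrable fun s => testValue ψ s • z s := fun ψ z hz =>
    integrableOn_univ.1 ((integrableOn_univ.2 hz).continuousOn_smul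
      (testValue ψ).continuous.continuousOn isCompact_univ)
  refine (sub_ae_eq_zero _ _).1
    (ae_eq_zero_of_integral_testValue_smul_eq_zero (hint.sub hint') fun ψ => ?_)
  simp_rw [Pi.sub_apply, smul_sub]
  rw [integral_sub (hψ ψ hint) (hψ ψ hint'), sub_eq_zero, ← neg_inj, ← isWeakDeriv_iff.1 hg ψ,
    ← isWeakDeriv_iff.1 hg' ψ]

end WeakDerivative

/-! ### The Sobolev path space -/

section PathSpace

variable {d : ℕ}

/-- The pairing `u ↦ ∫ k u` of square integrable paths with a continuous function `k`. -/
def pairing (k : C(I, ℝ)) : L2Path d →L[ℝ] Rd d :=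
  (ContinuousLinearMap.lsmul ℝ ℝ).lpPairing volume 2 2 (ContinuousMap.toLp 2 volume ℝ k)

theorem pairing_apply (k : C(I, ℝ)) (u : L2Path d) : pairing k u = ∫ s, k s • u s := by
  rw [pairing, ContinuousLinearMap.lpPairing_eq_integral]
  refine integral_congr_ae ?_
  filter_upwards [ContinuousMap.coeFn_toLp (p := 2) (𝕜 := ℝ) volume k] with s hs
  rw [hs, ContinuousLinearMap.lsmul_apply]

/-- The graph of the weak derivative, as an unbounded operator of `L²([0,1], ℝ^d)`. -/
def weakDerivGraph (d : ℕ) : Submodule ℝ (L2Path d × L2Path d) :=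
  ⨅ ψ : 𝓓(openUnitInterval, ℝ),
    ((pairing (testDeriv ψ)).coprod (pairing (testValue ψ))).ker

theorem mem_weakDerivGraph_iff {z : L2Path d × L2Path d} :
    z ∈ weakDerivGraph d ↔ IsWeakDeriv z.1 z.2 := by
  simp only [weakDerivGraph, Submodule.mem_iInf, LinearMap.mem_ker, isWeakDeriv_iff,
    ContinuousLinearMap.coe_coe, ContinuousLinearMap.coprod_apply, pairing_apply,
    eq_neg_iff_add_eq_zero]

theorem isClosed_weakDerivGraph : IsClosed (weakDerivGraph d : Set (L2Path d × L2Path d)) := by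
  rw [weakDerivGraph, Submodule.coe_iInf]
  exact isClosed_iInter fun ψ => ContinuousLinearMap.isClosed_ker _

/-- A continuous path as a square integrable path. -/
def toL2 : C(I, Rd d) →L[ℝ] L2Path d := ContinuousMap.toLp 2 volume ℝ

theorem coeFn_toL2 (x : C(I, Rd d)) : toL2 x =ᵐ[volume] x :=
  ContinuousMap.coeFn_toLp volume x

/-- The Sobolev space `H²([0,1], ℝ^d)` as a linear subspace of `C⁰ × L² × L²`; `H2Path` is only a
subtype. -/
def sobolev (d : ℕ) : Submodule ℝ (C(I, Rd d) × L2Path d × L2Path d) :=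
  (weakDerivGraph d).comap (toL2.prodMap (ContinuousLinearMap.fst ℝ _ _)).toLinearMap ⊓
    (weakDerivGraph d).comap (ContinuousLinearMap.snd ℝ _ _).toLinearMap

theorem mem_sobolev_iff {p : C(I, Rd d) × L2Path d × L2Path d} :
    p ∈ sobolev d ↔ IsWeakDeriv p.1 p.2.1 ∧ IsWeakDeriv p.2.1 p.2.2 := by
  have htoL2 : IsWeakDeriv (toL2 p.1) p.2.1 ↔ IsWeakDeriv p.1 p.2.1 :=
    ⟨fun h => h.congr_ae (coeFn_toL2 _) .rfl, fun h => h.congr_ae (coeFn_toL2 _).symm .rfl⟩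
  rw [← htoL2]
  exact and_congr mem_weakDerivGraph_iff mem_weakDerivGraph_iff

theorem isClosed_sobolev : IsClosed (sobolev d : Set (C(I, Rd d) × L2Path d × L2Path d)) :=
  (isClosed_weakDerivGraph.preimage (ContinuousLinearMap.continuous _)).inter
    (isClosed_weakDerivGraph.preimage (ContinuousLinearMap.continuous _))

instance : CompleteSpace (sobolev d) := isClosed_sobolev.completeSpace_coe

instance : ContinuousAdd (sobolev d) := (sobolev d).toAddSubmonoid.continuousAdd

/-- The path space as a linear space. -/
def pathHomeomorph : H2Path d ≃ₜ sobolev d :=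
  (Homeomorph.refl _).subtype fun _ => mem_sobolev_iff.symm

instance : PolishSpace (H2Path d) := by
  have htwo : Fact ((2 : ℝ≥0∞) ≠ ⊤) := ⟨ENNReal.ofNat_ne_top⟩
  have hL2 : SecondCountableTopology (L2Path d) := inferInstance
  have hsobolev : PolishSpace (sobolev d) := inferInstance
  exact pathHomeomorph.isClosedEmbedding.polishSpace

instance : Nonempty (H2Path d) := ⟨pathHomeomorph.symm 0⟩

theorem integrable_coeFn_L2Path (u : L2Path d) : Integrable u :=
  (Lp.memLp u).integrable one_le_two

theorem eq_of_forall_eval_eq {x y : H2Path d} (h : ∀ s, eval s x = eval s y) : x = y := by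
  obtain ⟨⟨x, u, v⟩, hu, hv⟩ := x
  obtain ⟨⟨x', u', v'⟩, hu', hv'⟩ := y
  obtain rfl : x = x' := ContinuousMap.ext h
  obtain rfl : u = u' := Lp.ext
    (hu.unique hu' (integrable_coeFn_L2Path u) (integrable_coeFn_L2Path u'))
  obtain rfl : v = v' := Lp.ext
    (hv.unique hv' (integrable_coeFn_L2Path v) (integrable_coeFn_L2Path v'))
  rfl

theorem measurableEmbedding_eval_denseSeq : MeasurableEmbedding
    fun (x : H2Path d) (k : ℕ) => eval (TopologicalSpace.denseSeq I k) x := by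
  refine (continuous_pi fun k => continuous_eval _).measurableEmbedding fun x y hxy => ?_
  have heq : ⇑x.1.1 = y.1.1 := Continuous.ext_on (TopologicalSpace.denseRange_denseSeq I)
    x.1.1.continuous y.1.1.continuous (forall_mem_range.2 (congrFun hxy))
  exact eq_of_forall_eval_eq (congrFun heq)

theorem measurable_of_forall_measurable_eval {X : Type*} [MeasurableSpace X] {φ : X → H2Path d}
    (h : ∀ s, Measurable fun x => eval s (φ x)) : Measurable φ :=
  measurableEmbedding_eval_denseSeq.measurable_comp_iff.1 (measurable_pi_iff.2 fun _ => h _)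

/-- The second derivative, as a linear operator. -/
def accL : sobolev d →L[ℝ] L2Path d :=
  ContinuousLinearMap.snd ℝ _ _ ∘L ContinuousLinearMap.snd ℝ _ _ ∘L (sobolev d).subtypeL

/-- Evaluation at a finite family of times, as a linear operator. -/
def evalL {ι : Type*} (t : ι → I) : sobolev d →L[ℝ] (ι → Rd d) :=
  ContinuousLinearMap.pi fun i =>
    ContinuousMap.evalCLM ℝ (t i) ∘L ContinuousLinearMap.fst ℝ _ _ ∘L (sobolev d).subtypeL

theorem energy_eq_enorm_sq (x : H2Path d) : energy x = ‖accL (pathHomeomorph x)‖ₑ ^ 2 := by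
  have h := eLpNorm_nnreal_pow_eq_lintegral (f := acc x) (μ := volume) (p := 2) two_ne_zero
  simp only [NNReal.coe_ofNat, ENNReal.coe_ofNat, ENNReal.rpow_ofNat] at h
  rw [energy, ← h, ← Lp.enorm_def]
  rfl

theorem continuous_energy : Continuous (energy : H2Path d → ℝ≥0∞) := by
  rw [funext energy_eq_enorm_sq]
  exact (ENNReal.continuous_pow 2).comp (accL.continuous.comp pathHomeomorph.continuous).enorm

theorem accL_surjective : Function.Surjective (accL : sobolev d → L2Path d) := fun u => by
  have hu := integrable_coeFn_L2Path u
  let v : C(I, Rd d) := ⟨_, continuous_setIntegral_Iic hu⟩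
  have hv : Integrable v :=
    v.continuous.integrable_of_hasCompactSupport (HasCompactSupport.of_compactSpace _)
  let x : C(I, Rd d) := ⟨_, continuous_setIntegral_Iic hv⟩
  exact ⟨⟨(x, toL2 v, u), mem_sobolev_iff.2
    ⟨(isWeakDeriv_setIntegral_Iic hv).congr_ae .rfl (coeFn_toL2 v).symm,
      (isWeakDeriv_setIntegral_Iic hu).congr_ae (coeFn_toL2 v).symm .rfl⟩⟩, rfl⟩

theorem exists_eval_eq_polynomial_smul (p : Polynomial ℝ) (v : Rd d) :
    ∃ x : H2Path d, ∀ s, eval s x = p.eval (s : ℝ) • v := by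
  let f : Polynomial ℝ → C(I, Rd d) := fun q => ⟨fun s => q.eval (s : ℝ) • v, by fun_prop⟩
  have hf : ∀ q, IsWeakDeriv (f q) (f q.derivative) := fun q =>
    isWeakDeriv_of_hasDerivAt (f := fun x => q.eval x • v)
      (fun x => (q.hasDerivAt x).smul_const v) (by fun_prop)
  exact ⟨⟨(f p, toL2 (f p.derivative), toL2 (f p.derivative.derivative)),
    (hf _).congr_ae .rfl (coeFn_toL2 _).symm,
    (hf _).congr_ae (coeFn_toL2 _).symm (coeFn_toL2 _).symm⟩, fun s => rfl⟩

theorem evalL_surjective {ι : Type*} [Finite ι] {t : ι → I} (ht : Function.Injective t) :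
    Function.Surjective (evalL t : sobolev d → ι → Rd d) := fun y => by
  classical
  have := Fintype.ofFinite ι
  choose x hx using fun i => exists_eval_eq_polynomial_smul
    (Lagrange.basis Finset.univ (fun i => (t i : ℝ)) i) (y i)
  have hinj : InjOn (fun i => (t i : ℝ)) (Finset.univ : Finset ι) :=
    (Subtype.val_injective.comp ht).injOn
  have heval : ∀ i j, evalL t (pathHomeomorph (x i)) j =
      (Lagrange.basis Finset.univ (fun i => (t i : ℝ)) i).eval (t j : ℝ) • y i :=
    fun i j => hx i (t j)
  refine ⟨∑ i, pathHomeomorph (x i), funext fun j => ?_⟩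
  rw [map_sum, Finset.sum_apply, Finset.sum_eq_single_of_mem j (Finset.mem_univ j), heval,
    Lagrange.eval_basis_self hinj (Finset.mem_univ j), one_smul]
  intro i _ hij
  rw [heval, Lagrange.eval_basis_of_ne (v := fun i => (t i : ℝ)) hij (Finset.mem_univ j), zero_smul]

end PathSpace

/-! ### Minimal interpolation -/

section Interpolation

section Abstract

variable {𝕜 X H V : Type*} [RCLike 𝕜] [NormedAddCommGroup X] [NormedSpace 𝕜 X] [CompleteSpace X]
  [NormedAddCommGroup V] [NormedSpace 𝕜 V] [FiniteDimensional 𝕜 V]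

theorem isClosed_map_ker [NormedAddCommGroup H] [NormedSpace 𝕜 H] [CompleteSpace H] {A : X →L[𝕜] H}
    (hA : Function.Surjective A) (B : X →L[𝕜] V) :
    IsClosed (B.ker.map A.toLinearMap : Set H) := by
  have hcomap : (B.ker.map A.toLinearMap).comap A.toLinearMap =
      (A.ker.map B.toLinearMap).comap B.toLinearMap := by
    rw [Submodule.comap_map_eq, Submodule.comap_map_eq, sup_comm]
  rw [← ((A.isOpenMap hA).isQuotientMap A.continuous hA).isClosed_preimage]
  change IsClosed ((B.ker.map A.toLinearMap).comap A.toLinearMap : Set X)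
  rw [hcomap]
  exact (A.ker.map B.toLinearMap).closed_of_finiteDimensional.preimage B.continuous

variable [NormedAddCommGroup H] [InnerProductSpace 𝕜 H] [CompleteSpace H]

theorem exists_rightInverse_norm_le {A : X →L[𝕜] H} (hA : Function.Surjective A) {B : X →L[𝕜] V}
    (hB : Function.Surjective B) :
    ∃ Φ : V →L[𝕜] X, (∀ y, B (Φ y) = y) ∧ ∀ x, ‖A (Φ (B x))‖ ≤ ‖A x‖ := by
  set N : Submodule 𝕜 H := B.ker.map A.toLinearMap
  have : CompleteSpace N := (isClosed_map_ker hA B).completeSpace_coe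
  -- On the preimage of `Nᗮ`, the map `B` is still onto, and `‖A x‖` is minimal among solutions.
  let S : Submodule 𝕜 X := Nᗮ.comap A.toLinearMap
  have hsurj : Function.Surjective (B.toLinearMap.domRestrict S) := fun y => by
    obtain ⟨x, rfl⟩ := hB y
    obtain ⟨z, hz : B z = 0, hzx : A z = N.starProjection (A x)⟩ := N.starProjection_apply_mem (A x)
    refine ⟨⟨x - z, ?_⟩, ?_⟩
    · change A (x - z) ∈ Nᗮ
      rw [map_sub, hzx]
      exact N.sub_starProjection_mem_orthogonal (A x)
    · change B (x - z) = B x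
      rw [map_sub, hz, sub_zero]
  obtain ⟨g, hg⟩ := (B.toLinearMap.domRestrict S).exists_rightInverse_of_surjective
    (LinearMap.range_eq_top.2 hsurj)
  have hBg : ∀ y, B (g y) = y := LinearMap.congr_fun hg
  refine ⟨LinearMap.toContinuousLinearMap (S.subtype ∘ₗ g), hBg, fun x => ?_⟩
  change ‖A (g (B x))‖ ≤ ‖A x‖
  have hN : A (x - g (B x)) ∈ N := ⟨_, by simp [hBg], rfl⟩
  have hproj : Nᗮ.starProjection (A x) = A (g (B x)) :=
    Submodule.eq_starProjection_of_mem_orthogonal' (g (B x)).2 (N.le_orthogonal_orthogonal hN)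
      (by rw [map_sub, add_sub_cancel])
  exact hproj ▸ Nᗮ.norm_starProjection_apply_le (A x)

end Abstract

variable {d : ℕ} {ι : Type*} [Finite ι] {t : ι → I}

theorem exists_spline (ht : Function.Injective t) : ∃ Φ : (ι → Rd d) →L[ℝ] sobolev d,
    (∀ y, evalL t (Φ y) = y) ∧ ∀ w, ‖accL (Φ (evalL t w))‖ ≤ ‖accL w‖ :=
  have := Fintype.ofFinite ι
  exists_rightInverse_norm_le (𝕜 := ℝ) (X := sobolev d) (H := L2Path d) (V := ι → Rd d)
    accL_surjective (evalL_surjective ht)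

/-- The spline of least energy through given points at the times `t`, linear in the points. -/
def spline (ht : Function.Injective t) : (ι → Rd d) →L[ℝ] sobolev d :=
  (exists_spline ht).choose

theorem evalL_spline (ht : Function.Injective t) (y : ι → Rd d) : evalL t (spline ht y) = y :=
  (exists_spline ht).choose_spec.1 y

/-- The energy of the spline of least energy, as a cost function of the interpolated points. -/
def splineCost (ht : Function.Injective t) (y : ι → Rd d) : NNReal := ‖accL (spline ht y)‖₊ ^ 2

theorem continuous_splineCost (ht : Function.Injective t) :
    Continuous (splineCost ht : (ι → Rd d) → NNReal) := by
  unfold splineCost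
  fun_prop

theorem splineCost_eval_le_energy (ht : Function.Injective t) (x : H2Path d) :
    splineCost ht (fun i => eval (t i) x) ≤ energy x := by
  rw [energy_eq_enorm_sq, splineCost, ENNReal.coe_pow]
  exact pow_le_pow_left' (enorm_le_iff_norm_le.2
    ((exists_spline ht).choose_spec.2 (pathHomeomorph x))) 2

end Interpolation

/-! ### Multi-marginal transport -/

section Couplings

variable {ι : Type*} {X : ι → Type*} [∀ i, MeasurableSpace (X i)] (ρ : ∀ i, Measure (X i))

/-- The couplings of a family of measures: the probability measures on the product with these
marginals. -/
def couplings : Set (ProbabilityMeasure (∀ i, X i)) :=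
  {γ | ∀ i, (γ : Measure (∀ i, X i)).map (fun y => y i) = ρ i}

variable [∀ i, IsProbabilityMeasure (ρ i)]

theorem couplings_nonempty : (couplings ρ).Nonempty :=
  ⟨⟨Measure.infinitePi ρ, inferInstance⟩,
    fun i => (measurePreserving_eval_infinitePi ρ i).map_eq⟩

variable [Countable ι] [∀ i, TopologicalSpace (X i)] [∀ i, PolishSpace (X i)]
  [∀ i, BorelSpace (X i)]

theorem isClosed_couplings : IsClosed (couplings ρ) := by
  have hmarginal : couplings ρ =
      ⋂ i, {γ | γ.map (measurable_pi_apply i).aemeasurable = ⟨ρ i, inferInstance⟩} := by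
    ext γ
    simp only [couplings, mem_ofPred_eq, mem_iInter]
    exact forall_congr' fun i => ⟨fun h => Subtype.ext h, congrArg Subtype.val⟩
  rw [hmarginal]
  exact isClosed_iInter fun i =>
    isClosed_eq (ProbabilityMeasure.continuous_map (continuous_apply i)) continuous_const

theorem isTightMeasureSet_couplings :
    IsTightMeasureSet {x : Measure (∀ i, X i) | ∃ γ ∈ couplings ρ, (γ : Measure _) = x} := by
  rw [isTightMeasureSet_iff_exists_isCompact_measure_compl_le]
  intro ε hε
  obtain ⟨ε', hε', hsum⟩ := ENNReal.exists_pos_sum_of_countable' hε.ne' ι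
  choose K hK hKε using fun i => isTightMeasureSet_iff_exists_isCompact_measure_compl_le.1
    (isTightMeasureSet_singleton (μ := ρ i)) (ε' i) (hε' i)
  refine ⟨univ.pi K, isCompact_univ_pi hK, ?_⟩
  rintro _ ⟨γ, hγ, rfl⟩
  have hcompl : (univ.pi K)ᶜ = ⋃ i, (fun y : ∀ i, X i => y i) ⁻¹' (K i)ᶜ := by
    ext y
    simp only [mem_compl_iff, mem_univ_pi, not_forall, mem_iUnion, mem_preimage]
  have hγK : ∀ i, (γ : Measure _) ((fun y : ∀ i, X i => y i) ⁻¹' (K i)ᶜ) ≤ ε' i := fun i => by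
    rw [← Measure.map_apply (measurable_pi_apply i) (hK i).measurableSet.compl, hγ i]
    exact hKε i _ rfl
  rw [hcompl]
  exact (measure_iUnion_le _).trans ((ENNReal.tsum_le_tsum hγK).trans hsum.le)

theorem isCompact_couplings : IsCompact (couplings ρ) :=
  (isClosed_couplings ρ).closure_eq ▸
    isCompact_closure_of_isTightMeasureSet (isTightMeasureSet_couplings ρ)

end Couplings

theorem lowerSemicontinuous_lintegral {X : Type*} [TopologicalSpace X] [MeasurableSpace X]
    [OpensMeasurableSpace X] {c : X → NNReal} (hc : Continuous c) :
    LowerSemicontinuous fun μ : ProbabilityMeasure X => ∫⁻ x, c x ∂μ := by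
  let cut : ℕ → BoundedContinuousFunction X NNReal := fun k =>
    .mkOfBound ⟨fun x => min (c x) k, by fun_prop⟩ ((k : NNReal) - 0) fun x y =>
      Real.dist_le_of_mem_Icc ⟨NNReal.coe_nonneg _, NNReal.coe_le_coe.2 (min_le_right _ _)⟩
        ⟨NNReal.coe_nonneg _, NNReal.coe_le_coe.2 (min_le_right _ _)⟩
  have hcut_apply : ∀ k x, (cut k x : ℝ≥0∞) = (c x : ℝ≥0∞) ⊓ k := fun k x => ENNReal.coe_min _ _
  have hcut : ∀ μ : ProbabilityMeasure X, ∫⁻ x, c x ∂μ = ⨆ k, ∫⁻ x, cut k x ∂μ := fun μ => by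
    have hmono : Monotone fun (k : ℕ) (x : X) => (c x : ℝ≥0∞) ⊓ k :=
      fun j k hjk x => inf_le_inf_left _ (Nat.cast_le.2 hjk)
    simp only [hcut_apply]
    rw [← lintegral_iSup (fun k => by fun_prop) hmono]
    simp only [← inf_iSup_eq, ENNReal.iSup_natCast, inf_top_eq]
  simp only [hcut]
  exact lowerSemicontinuous_iSup fun k =>
    (ProbabilityMeasure.continuous_lintegral_boundedContinuousFunction (cut k)).lowerSemicontinuous

theorem exists_isMinOn_lintegral_couplings {ι : Type*} [Countable ι] {X : ι → Type*}
    [∀ i, TopologicalSpace (X i)] [∀ i, PolishSpace (X i)] [∀ i, MeasurableSpace (X i)]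
    [∀ i, BorelSpace (X i)] (ρ : ∀ i, Measure (X i)) [∀ i, IsProbabilityMeasure (ρ i)]
    {c : (∀ i, X i) → NNReal} (hc : Continuous c) :
    ∃ γ ∈ couplings ρ,
      IsMinOn (fun γ : ProbabilityMeasure (∀ i, X i) => ∫⁻ y, c y ∂γ) (couplings ρ) γ :=
  (lowerSemicontinuous_lintegral hc).lowerSemicontinuousOn _ |>.exists_isMinOn
    (couplings_nonempty ρ) (isCompact_couplings ρ)

/-! ### The Kantorovich problem -/

theorem kantorovichCost_map {d : ℕ} {X : Type*} [MeasurableSpace X] (μ : Measure X)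
    {φ : X → H2Path d} (hφ : Measurable φ) :
    kantorovichCost (μ.map φ) = ∫⁻ x, energy (φ x) ∂μ :=
  lintegral_map continuous_energy.measurable hφ

section Kantorovich

variable {d n : ℕ} {t : Fin n → I} {ρ : Fin n → Measure (Rd d)}

theorem lintegral_splineCost_le_kantorovichCost (ht : Function.Injective t)
    {μ : Measure (H2Path d)} (hμ : KantorovichAdmissible t ρ μ) :
    ∃ γ ∈ couplings ρ, ∫⁻ y : Fin n → Rd d, splineCost ht y ∂γ ≤ kantorovichCost μ := by
  have := hμ.isProbabilityMeasure
  have hknots : Measurable fun (x : H2Path d) i => eval (t i) x :=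
    (continuous_pi fun i => continuous_eval _).measurable
  refine ⟨⟨μ.map _, Measure.isProbabilityMeasure_map hknots.aemeasurable⟩, fun i => ?_, ?_⟩
  · rw [ProbabilityMeasure.coe_mk, Measure.map_map (measurable_pi_apply i) hknots]
    exact hμ.marginal i
  · rw [ProbabilityMeasure.coe_mk,
      lintegral_map (continuous_splineCost ht).measurable.coe_nnreal_ennreal hknots]
    exact lintegral_mono (splineCost_eval_le_energy ht)

theorem exists_kantorovichCost_eq_lintegral_splineCost (ht : Function.Injective t)
    {γ : ProbabilityMeasure (Fin n → Rd d)} (hγ : γ ∈ couplings ρ) :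
    ∃ μ, KantorovichAdmissible t ρ μ ∧
      kantorovichCost μ = ∫⁻ y : Fin n → Rd d, splineCost ht y ∂γ := by
  have hspline : Measurable fun y : Fin n → Rd d => pathHomeomorph.symm (spline ht y) :=
    (pathHomeomorph.symm.continuous.comp (spline ht).continuous).measurable
  refine ⟨(γ : Measure _).map _, ⟨Measure.isProbabilityMeasure_map hspline.aemeasurable,
    fun i => ?_⟩, ?_⟩
  · rw [Measure.map_map (continuous_eval _).measurable hspline, ← hγ i]
    exact congrArg (Measure.map · (γ : Measure (Fin n → Rd d)))
      (funext fun y => congrFun (evalL_spline ht y) i)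
  · rw [kantorovichCost_map _ hspline]
    refine lintegral_congr fun y => ?_
    rw [energy_eq_enorm_sq, Homeomorph.apply_symm_apply, splineCost, ENNReal.coe_pow]
    rfl

variable [∀ i, IsProbabilityMeasure (ρ i)]

theorem exists_kantorovichCost_eq_kantorovichInf (ht : Function.Injective t) :
    ∃ μ, KantorovichAdmissible t ρ μ ∧ kantorovichCost μ = kantorovichInf t ρ := by
  obtain ⟨γ, hγ, hmin⟩ := exists_isMinOn_lintegral_couplings ρ (continuous_splineCost ht)
  obtain ⟨μ, hμ, hcost⟩ := exists_kantorovichCost_eq_lintegral_splineCost ht hγ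
  refine ⟨μ, hμ, le_antisymm (le_iInf₂ fun μ' hμ' => ?_) (iInf₂_le μ hμ)⟩
  obtain ⟨γ', hγ', hle⟩ := lintegral_splineCost_le_kantorovichCost ht hμ'
  exact hcost.trans_le ((hmin hγ').trans hle)

theorem kantorovichInf_lt_top (ht : Function.Injective t) (hρ : ∀ i, MemLp id 2 (ρ i)) :
    kantorovichInf t ρ < ⊤ := by
  obtain ⟨γ, hγ⟩ := couplings_nonempty ρ
  obtain ⟨μ, hμ, hcost⟩ := exists_kantorovichCost_eq_lintegral_splineCost ht hγ
  have hid : MemLp (id : (Fin n → Rd d) → _) 2 (γ : Measure _) := memLp_pi_iff.2 fun i =>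
    (hγ i ▸ hρ i).comp_of_map (measurable_pi_apply i).aemeasurable
  have hacc := (accL ∘L spline ht).comp_memLp' hid
  refine (iInf₂_le μ hμ).trans_lt (hcost.trans_lt ?_)
  have hfin := lintegral_rpow_enorm_lt_top_of_eLpNorm_lt_top two_ne_zero ENNReal.ofNat_ne_top
    hacc.eLpNorm_lt_top
  simp only [ENNReal.toReal_ofNat, ENNReal.rpow_ofNat] at hfin
  simpa only [splineCost, ENNReal.coe_pow] using! hfin

end Kantorovich

theorem memLp_id_of_isCompact_support {E : Type*} [NormedAddCommGroup E] [MeasurableSpace E]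
    [BorelSpace E] [SecondCountableTopology E] {ν : Measure E} [IsFiniteMeasure ν]
    (h : IsCompact ν.support) {p : ℝ≥0∞} : MemLp id p ν := by
  obtain ⟨C, hC⟩ := h.isBounded.exists_norm_le
  refine .of_bound aestronglyMeasurable_id C ?_
  filter_upwards [Measure.support_mem_ae (μ := ν)] with x hx using hC x hx

/-! ### The Monge problem -/

section Monge

variable {d n : ℕ} {μ₀ : Measure (Rd d)} {t : Fin n → I} {ρ : Fin n → Measure (Rd d)}
  {φ : Rd d → H2Path d}

theorem MongeAdmissible.measurable_path (h : MongeAdmissible μ₀ t ρ φ) : Measurable φ :=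
  measurable_of_forall_measurable_eval h.measurable

theorem mongeAdmissible_iff [IsProbabilityMeasure μ₀] (hφ : Measurable φ) :
    MongeAdmissible μ₀ t ρ φ ↔ KantorovichAdmissible t ρ (μ₀.map φ) := by
  have hmarginal : ∀ i, (μ₀.map φ).map (eval (t i)) = μ₀.map fun x => eval (t i) (φ x) := fun i =>
    Measure.map_map (continuous_eval _).measurable hφ
  exact ⟨fun h => ⟨Measure.isProbabilityMeasure_map hφ.aemeasurable,
      fun i => (hmarginal i).trans (h.marginal i)⟩,
    fun h => ⟨fun s => (continuous_eval s).measurable.comp hφ,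
      fun i => (hmarginal i).symm.trans (h.marginal i)⟩⟩

theorem kantorovichInf_le_mongeCost [IsProbabilityMeasure μ₀] (h : MongeAdmissible μ₀ t ρ φ) :
    kantorovichInf t ρ ≤ mongeCost μ₀ φ :=
  (iInf₂_le _ ((mongeAdmissible_iff h.measurable_path).1 h)).trans_eq
    (kantorovichCost_map μ₀ h.measurable_path)

theorem mongeInf_eq_kantorovichInf [IsProbabilityMeasure μ₀] [NullSingletonClass μ₀] :
    mongeInf μ₀ t ρ = kantorovichInf t ρ := by
  refine le_antisymm (le_iInf₂ fun μ hμ => ?_) (le_iInf₂ fun φ hφ => kantorovichInf_le_mongeCost hφ)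
  have := hμ.isProbabilityMeasure
  obtain ⟨φ, hφ, rfl⟩ := exists_measurable_map_eq_of_isProbabilityMeasure μ₀ μ
  exact (iInf₂_le φ ((mongeAdmissible_iff hφ).2 hμ)).trans_eq (kantorovichCost_map μ₀ hφ).symm

end Monge

section Correction

variable {d : ℕ} {ι : Type*} [Finite ι] [DecidableEq ι] {t : ι → I}

/-- The path `x`, translated by the spline which moves its position at the time `t i` to `v` and
vanishes at the other times of the family `t`. -/
def moveKnot (ht : Function.Injective t) (i : ι) (v : Rd d) (x : H2Path d) : H2Path d :=
  pathHomeomorph.symm (pathHomeomorph x + spline ht (Pi.single i (v - eval (t i) x)))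

theorem eval_moveKnot (ht : Function.Injective t) (i j : ι) (v : Rd d) (x : H2Path d) :
    eval (t j) (moveKnot ht i v x) = if j = i then v else eval (t j) x := by
  have h : eval (t j) (moveKnot ht i v x) =
      eval (t j) x + (Pi.single i (v - eval (t i) x) : ι → Rd d) j :=
    congrArg (eval (t j) x + ·) (congrFun (evalL_spline ht _) j)
  rw [h]
  split_ifs with hji
  · rw [hji, Pi.single_eq_same, add_sub_cancel]
  · rw [Pi.single_eq_of_ne hji, add_zero]

theorem continuous_moveKnot (ht : Function.Injective t) (i : ι) :
    Continuous fun p : Rd d × H2Path d => moveKnot ht i p.1 p.2 := by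
  have hshift : Continuous fun p : Rd d × H2Path d => p.1 - eval (t i) p.2 :=
    continuous_fst.sub ((continuous_eval _).comp continuous_snd)
  exact pathHomeomorph.symm.continuous.comp ((pathHomeomorph.continuous.comp continuous_snd).add
    ((spline ht).continuous.comp ((continuous_single i).comp hshift)))

theorem measurable_moveKnot (ht : Function.Injective t) (i : ι) {X : Type*} [MeasurableSpace X]
    {v : X → Rd d} (hv : Measurable v) {x : X → H2Path d} (hx : Measurable x) :
    Measurable fun a => moveKnot ht i (v a) (x a) := by
  have h := (continuous_moveKnot (d := d) ht i).measurable.comp (hv.prodMk hx)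
  exact h

theorem enorm_add_sq_le {E : Type*} [SeminormedAddCommGroup E] {u v : E} {η : NNReal}
    (hv : ‖v‖ ≤ η) : ‖u + v‖ₑ ^ 2 ≤ (1 + η) * ‖u‖ₑ ^ 2 + (η ^ 2 + η) := by
  simp only [enorm_eq_nnnorm]
  norm_cast
  rw [← NNReal.coe_le_coe]
  push_cast
  calc ‖u + v‖ ^ 2 ≤ (‖u‖ + η) ^ 2 := by gcongr; exact (norm_add_le u v).trans (by gcongr)
    _ ≤ (1 + η) * ‖u‖ ^ 2 + (η ^ 2 + η) := by
      nlinarith [mul_nonneg η.coe_nonneg (sq_nonneg (‖u‖ - 1))]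

theorem exists_energy_moveKnot_le (ht : Function.Injective t) (i : ι) {η : NNReal} (hη : 0 < η) :
    ∃ δ > 0, ∀ (v : Rd d) (x : H2Path d), dist v (eval (t i) x) ≤ δ →
      energy (moveKnot ht i v x) ≤ (1 + η) * energy x + (η ^ 2 + η) := by
  let L : Rd d →L[ℝ] L2Path d :=
    accL ∘L spline ht ∘L ContinuousLinearMap.single ℝ (fun _ => Rd d) i
  refine ⟨η / (‖L‖ + 1), by positivity, fun v x hvx => ?_⟩
  have hL : ‖L (v - eval (t i) x)‖ ≤ η := by
    calc ‖L (v - eval (t i) x)‖ ≤ ‖L‖ * (η / (‖L‖ + 1)) :=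
          L.le_opNorm_of_le (dist_eq_norm v _ ▸ hvx)
      _ ≤ (‖L‖ + 1) * (η / (‖L‖ + 1)) := by gcongr; exact (lt_add_one _).le
      _ = η := by field_simp
  have hacc : accL (pathHomeomorph (moveKnot ht i v x)) =
      accL (pathHomeomorph x) + L (v - eval (t i) x) := by
    rw [moveKnot, Homeomorph.apply_symm_apply, map_add]
    rfl
  rw [energy_eq_enorm_sq, energy_eq_enorm_sq, hacc]
  exact enorm_add_sq_le hL

end Correction

section MongeIdentity

variable {d n : ℕ} {t : Fin n → I} {ρ : Fin n → Measure (Rd d)} {i₀ : Fin n}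

theorem mongeAdmissible_moveKnot (ht : Function.Injective t) {T : Rd d → H2Path d}
    (hT : MongeAdmissible (ρ i₀) t ρ T) :
    MongeAdmissible (ρ i₀) t ρ fun x => moveKnot ht i₀ x (T x) := by
  refine ⟨fun s => (continuous_eval s).measurable.comp
    (measurable_moveKnot ht i₀ measurable_id hT.measurable_path), fun i => ?_⟩
  simp only [eval_moveKnot]
  split_ifs with hi
  · rw [hi]
    exact Measure.map_id
  · exact hT.marginal i

theorem mongeInfId_le_mul_kantorovichCost_add (ht : Function.Injective t) (hi₀ : t i₀ = 0)
    [IsProbabilityMeasure (ρ i₀)] [NullSingletonClass (ρ i₀)] {μ : Measure (H2Path d)}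
    (hμ : KantorovichAdmissible t ρ μ) {η : NNReal} (hη : 0 < η) :
    mongeInfId (ρ i₀) t ρ ≤ (1 + η) * kantorovichCost μ + (η ^ 2 + η) := by
  obtain ⟨δ, hδ, henergy⟩ := exists_energy_moveKnot_le (d := d) ht i₀ hη
  obtain ⟨T, hT, rfl, hclose⟩ := exists_measurable_map_eq_dist_le (ρ i₀) μ
    (continuous_eval (t i₀)).measurable (hμ.marginal i₀) hδ
  have hadm := mongeAdmissible_moveKnot ht ((mongeAdmissible_iff hT).2 hμ)
  have hid : ∀ x, eval 0 (moveKnot ht i₀ x (T x)) = x := fun x => by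
    rw [← hi₀, eval_moveKnot, if_pos rfl]
  calc mongeInfId (ρ i₀) t ρ
      ≤ ∫⁻ x, energy (moveKnot ht i₀ x (T x)) ∂ρ i₀ := iInf₂_le_of_le _ hadm (iInf_le _ hid)
    _ ≤ ∫⁻ x, ((1 + η) * energy (T x) + (η ^ 2 + η)) ∂ρ i₀ :=
        lintegral_mono_ae (hclose.mono fun x => henergy x (T x))
    _ = (1 + η) * kantorovichCost ((ρ i₀).map T) + (η ^ 2 + η) := by
        rw [lintegral_add_right _ measurable_const,
          lintegral_const_mul (f := fun x => energy (T x)) _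
            (continuous_energy.measurable.comp hT), lintegral_const,
          measure_univ, mul_one, kantorovichCost_map _ hT]

theorem mongeInfId_eq_kantorovichInf (ht : Function.Injective t) (hi₀ : t i₀ = 0)
    [IsProbabilityMeasure (ρ i₀)] [NullSingletonClass (ρ i₀)] :
    mongeInfId (ρ i₀) t ρ = kantorovichInf t ρ := by
  refine le_antisymm (le_iInf₂ fun μ hμ => ?_)
    (le_iInf₂ fun φ hφ => le_iInf fun _ => kantorovichInf_le_mongeCost hφ)
  rcases eq_or_ne (kantorovichCost μ) ⊤ with htop | hfin
  · exact htop ▸ le_top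
  have hcoe : Tendsto (fun η : NNReal => (η : ℝ≥0∞)) (𝓝[>] 0) (𝓝 0) :=
    (ENNReal.continuous_coe.tendsto 0).mono_left nhdsWithin_le_nhds
  have hlim : Tendsto (fun η : NNReal => (1 + η) * kantorovichCost μ + (η ^ 2 + η)) (𝓝[>] 0)
      (𝓝 ((1 + 0) * kantorovichCost μ + (0 ^ 2 + 0))) :=
    (ENNReal.Tendsto.mul_const (hcoe.const_add 1) (.inr hfin)).add
      ((ENNReal.Tendsto.pow hcoe).add hcoe)
  rw [add_zero, one_mul, add_zero, zero_pow two_ne_zero, add_zero] at hlim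
  exact ge_of_tendsto hlim (eventually_nhdsWithin_of_forall fun η hη =>
    mongeInfId_le_mul_kantorovichCost_add ht hi₀ hμ hη)

end MongeIdentity

end WassersteinSpline

end

open WassersteinSpline in
theorem mainTheorem1_general {d n : ℕ} {t : Fin n → unitInterval} (ht : Function.Injective t)
    {i₀ : Fin n} (hi₀ : t i₀ = 0) (ρ : Fin n → Measure (Rd d)) [∀ i, IsProbabilityMeasure (ρ i)]
    [NullSingletonClass (ρ i₀)] :
    (∀ (μ₀ : Measure (Rd d)) [IsProbabilityMeasure μ₀] [NullSingletonClass μ₀],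
      mongeInf μ₀ t ρ = kantorovichInf t ρ) ∧
    mongeInfId (ρ i₀) t ρ = kantorovichInf t ρ ∧
    ((∀ i, MemLp id 2 (ρ i)) → kantorovichInf t ρ < ⊤) ∧
    ∃ μ, KantorovichAdmissible t ρ μ ∧ kantorovichCost μ = kantorovichInf t ρ :=
  ⟨fun _ => mongeInf_eq_kantorovichInf, mongeInfId_eq_kantorovichInf ht hi₀,
    kantorovichInf_lt_top ht, exists_kantorovichCost_eq_kantorovichInf ht⟩

open WassersteinSpline in
theorem mainTheorem1 (d n : ℕ) (hn : 3 ≤ n) (t : Fin n → unitInterval) (ht : StrictMono t)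
    (ht_first : t ⟨0, by omega⟩ = 0) (ht_last : t ⟨n - 1, by omega⟩ = 1)
    (ρ : Fin n → MeasureTheory.Measure (Rd d))
    (hρ_prob : ∀ i, MeasureTheory.IsProbabilityMeasure (ρ i))
    (hρ_compact : ∀ i, IsCompact (ρ i).support)
    (hρ_atomless : ∀ x, ρ ⟨0, by omega⟩ {x} = 0) :
    -- (MS) for every atomless reference probability measure, in particular for the first marginal
    (∀ μ₀ : MeasureTheory.Measure (Rd d), MeasureTheory.IsProbabilityMeasure μ₀ →
      (∀ x, μ₀ {x} = 0) → mongeInf μ₀ t ρ = kantorovichInf t ρ) ∧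
    -- (MS) with the first marginal as reference measure and maps starting at the identity
    mongeInfId (ρ ⟨0, by omega⟩) t ρ = kantorovichInf t ρ ∧
    -- the Kantorovich infimum is finite and attained
    kantorovichInf t ρ < ⊤ ∧
    ∃ μ : MeasureTheory.Measure (H2Path d),
      KantorovichAdmissible t ρ μ ∧ kantorovichCost μ = kantorovichInf t ρ := by
  have : NullSingletonClass (ρ ⟨0, by omega⟩) := ⟨hρ_atomless⟩
  obtain ⟨hMonge, hId, hfin, hattained⟩ := mainTheorem1_general ht.injective ht_first ρ
  exact ⟨fun μ₀ _ hμ₀ => have : NullSingletonClass μ₀ := ⟨hμ₀⟩; hMonge μ₀, hId,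
    hfin fun i => memLp_id_of_isCompact_support (hρ_compact i), hattained⟩
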